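/- Let a dataset be a finite multiset of records from a set $\mathcal X$, and call two datasets neighbors if one is obtained from the other by adding one record. A randomized algorithm $M$ is $(\varepsilon,\delta)$-DP if $\Pr[M(x)\in S]\le e^{\varepsilon}\Pr[M(x')\in S]+\delta$ for all neighbors $x,x'$ and all outcome sets $S$. Let $\mathcal Y$ be a finite set with $d$ elements, let $0\le k\le d$ be an integer and let $\varepsilon>0$. Let $q$ be a quality score assigning a real number $q(x,y)$ to each dataset $x$ and each $y\in\mathcal Y$, and let $\Delta>0$ bound its sensitivity: $|q(x,y)-q(x',y)|\le\Delta$ for all neighbors $x,x'$ and all $y\in\mathcal Y$. Let $M$ be the one-shot Gumbel mechanism: on input $x$ it adds to each score $q(x,y)$, $y\in\mathcal Y$, an independent Gumbel random variable of scale $b=\Delta/\varepsilon$, i.e. with density $z\mapsto\frac1b\exp\left(-\left(z/b+e^{-z/b}\right)\right)$, and returns the ranked list of the $k$ elements of $\mathcal Y$ with the largest noisy scores, in decreasing order of noisy score (ties are broken by a fixed enumeration of $\mathcal Y$, independent of the data). For $a>0$ and $\delta\ge0$ put $$E_k(a,\delta)=\min\left\{ka,\ ka\cdot\frac{e^{a}-1}{e^{a}+1}+a\sqrt{2k\log(1/\delta)}\right\},$$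 where $E_k(a,0)=ka$ (as $\log(1/0)=\infty$) and, for $\delta>1$, the square root is read as $0$ (DP is then trivial). (i) For every $\delta\ge0$, $M$ is $(\varepsilon',\delta)$-DP with $$\varepsilon'=E_k(2\varepsilon,\delta)=\min\left\{2k\varepsilon,\ 2k\varepsilon\cdot\frac{e^{2\varepsilon}-1}{e^{2\varepsilon}+1}+2\varepsilon\sqrt{2k\log(1/\delta)}\right\}.$$ (ii) If moreover $q$ is monotonic in the dataset, i.e. either adding a record to a dataset never decreases any score, or adding a record to a dataset never increases any score, then for every $\delta\ge0$, $M$ is $(\varepsilon'',\delta)$-DP with $$\varepsilon''=E_k(\varepsilon,\delta)=\min\left\{k\varepsilon,\ k\varepsilon\cdot\frac{e^{\varepsilon}-1}{e^{\varepsilon}+1}+\varepsilon\sqrt{2k\log(1/\delta)}\right\}.$$ -/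

import Mathlib

open MeasureTheory

noncomputable section

/-- Two datasets (finite collections of records, possibly with repetitions) are neighbors if one
is obtained from the other by adding one record. -/
def Neighbors {X : Type*} (x x' : Multiset X) : Prop :=
  ∃ a : X, x' = a ::ₘ x ∨ x = a ::ₘ x'

/-- A randomized algorithm maps a dataset `x` and a random seed `ω`, drawn from `P`, to an outcome
`M x ω`. It is `(ε, δ)`-differentially private if `Pr[M x ∈ S] ≤ e^ε * Pr[M x' ∈ S] + δ` for all
neighbors `x`, `x'` and all outcome sets `S`. -/
def IsDP {X Ω O : Type*} [MeasurableSpace Ω] (P : Measure Ω) (M : Multiset X → Ω → O)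
    (ε δ : ℝ) : Prop :=
  ∀ x x' : Multiset X, Neighbors x x' → ∀ S : Set O,
    P {ω | M x ω ∈ S} ≤
      ENNReal.ofReal (Real.exp ε) * P {ω | M x' ω ∈ S} + ENNReal.ofReal δ

/-- `Δ` bounds the sensitivity of the quality score `q`. -/
def HasSensitivity {X Y : Type*} (q : Multiset X → Y → ℝ) (Δ : ℝ) : Prop :=
  ∀ x x' : Multiset X, Neighbors x x' → ∀ y : Y, |q x y - q x' y| ≤ Δ

/-- The quality score is monotonic in the dataset: adding a record never decreases any score,
or adding a record never increases any score. -/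
def IsMonotonicScore {X Y : Type*} (q : Multiset X → Y → ℝ) : Prop :=
  (∀ (x : Multiset X) (a : X) (y : Y), q x y ≤ q (a ::ₘ x) y) ∨
    (∀ (x : Multiset X) (a : X) (y : Y), q (a ::ₘ x) y ≤ q x y)

/-- The density of the Gumbel distribution with scale `b`. -/
def gumbelPDF (b z : ℝ) : ℝ := 1 / b * Real.exp (-(z / b + Real.exp (-(z / b))))

/-- The Gumbel distribution with scale `b > 0`. -/
def gumbelMeasure (b : ℝ) : Measure ℝ :=
  volume.withDensity (fun z => ENNReal.ofReal (gumbelPDF b z))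

/-- Independent Gumbel noise of scale `b`, one sample for each outcome. -/
def gumbelNoise (Y : Type*) [Fintype Y] (b : ℝ) : Measure (Y → ℝ) :=
  Measure.pi (fun _ : Y => gumbelMeasure b)

/-- The `k` outcomes with the largest values of `v`, listed in decreasing order of `v`. The
outcomes are enumerated by `e`, and ties are broken in favour of the earlier one. -/
def topK {Y : Type*} {d k : ℕ} (e : Fin d ≃ Y) (hk : k ≤ d) (v : Y → ℝ) : Fin k → Y :=
  fun j => e (Tuple.sort (fun i : Fin d => -v (e i)) (Fin.castLE hk j))

/-- The one-shot mechanism: add the noise `z` to the quality scores and return the ranked list of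
the `k` outcomes with the largest noisy scores. -/
def oneShotTopK {X Y : Type*} {d k : ℕ} (e : Fin d ≃ Y) (hk : k ≤ d)
    (q : Multiset X → Y → ℝ) (x : Multiset X) (z : Y → ℝ) : Fin k → Y :=
  topK e hk (fun y => q x y + z y)

/-- The privacy parameter of the composition of `k` algorithms that are each `ε`-DP: the minimum
of the basic and of the advanced composition bound. For `δ = 0` one has `log (1 / δ) = ∞`, so that
the minimum is `k * ε`. -/
def composedEps (k : ℕ) (ε δ : ℝ) : ℝ :=
  if δ = 0 then k * ε
  else min (k * ε)
    (k * ε * ((Real.exp ε - 1) / (Real.exp ε + 1)) + ε * Real.sqrt (2 * k * Real.log (1 / δ)))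

theorem isProbabilityMeasure_gumbelMeasure {b : ℝ} (hb : 0 < b) :
    IsProbabilityMeasure (gumbelMeasure b) := by
  have hd : ∀ z : ℝ, HasDerivAt (fun z => Real.exp (-Real.exp (-(z / b)))) (gumbelPDF b z) z := by
    intro z
    have h1 : HasDerivAt (fun z : ℝ => -(z / b)) (-(1 / b)) z := ((hasDerivAt_id z).div_const b).neg
    have h2 := h1.exp.neg.exp
    refine h2.congr_deriv ?_
    rw [gumbelPDF, neg_add, Real.exp_add]
    simp only [Pi.neg_apply]
    ring
  have hn : ∀ z, 0 ≤ gumbelPDF b z := fun z => by unfold gumbelPDF; positivity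
  have hc : Continuous (gumbelPDF b) := by unfold gumbelPDF; fun_prop
  have hbot : Filter.Tendsto (fun z => Real.exp (-Real.exp (-(z / b)))) Filter.atBot (nhds 0) := by
    refine Real.tendsto_exp_atBot.comp (Filter.tendsto_neg_atTop_atBot.comp
      (Real.tendsto_exp_atTop.comp (Filter.tendsto_neg_atBot_atTop.comp ?_)))
    exact Filter.tendsto_id.atBot_div_const hb
  have htop : Filter.Tendsto (fun z => Real.exp (-Real.exp (-(z / b)))) Filter.atTop (nhds 1) := by
    have h : Filter.Tendsto (fun z : ℝ => Real.exp (-(z / b))) Filter.atTop (nhds 0) :=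
      Real.tendsto_exp_atBot.comp (Filter.tendsto_neg_atTop_atBot.comp
        (Filter.tendsto_id.atTop_div_const hb))
    simpa [Function.comp_def] using (Real.continuous_exp.tendsto _).comp h.neg
  have hint : Integrable (gumbelPDF b) := by
    refine integrable_of_intervalIntegral_norm_tendsto (l := Filter.atTop) (a := fun t : ℝ => -t)
      (b := fun t : ℝ => t) 1 (fun t => (hc.integrableOn_Icc).mono_set Set.Ioc_subset_Icc_self)
      Filter.tendsto_neg_atTop_atBot Filter.tendsto_id ?_
    have : (fun t : ℝ => ∫ z in (-t)..t, ‖gumbelPDF b z‖) =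
        fun t : ℝ => Real.exp (-Real.exp (-(t / b))) - Real.exp (-Real.exp (-(-t / b))) := by
      funext t
      simp_rw [Real.norm_of_nonneg (hn _)]
      exact intervalIntegral.integral_eq_sub_of_hasDerivAt (fun z _ => hd z)
        (hc.intervalIntegrable _ _)
    rw [this]
    simpa using htop.sub (hbot.comp Filter.tendsto_neg_atTop_atBot)
  refine ⟨?_⟩
  rw [gumbelMeasure, withDensity_apply _ MeasurableSet.univ, Measure.restrict_univ,
    ← ofReal_integral_eq_lintegral_ofReal hint (Filter.Eventually.of_forall hn),
    integral_of_hasDerivAt_of_tendsto hd hint hbot htop]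
  simp

/-- All events of the form `topK e hk v ∈ S` are measurable. -/
theorem measurableSet_topK_mem {Y : Type*} [Fintype Y] {d k : ℕ} (e : Fin d ≃ Y) (hk : k ≤ d)
    (S : Set (Fin k → Y)) : MeasurableSet {v : Y → ℝ | topK e hk v ∈ S} := by
  have h : {v : Y → ℝ | topK e hk v ∈ S} =
      ⋃ σ ∈ {σ : Equiv.Perm (Fin d) | (fun j => e (σ (Fin.castLE hk j))) ∈ S},
        {v : Y → ℝ | σ = Tuple.sort (fun i : Fin d => -v (e i))} := by
    ext v
    simp only [Set.mem_ofPred_eq, Set.mem_iUnion, exists_prop, exists_eq_right]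
    rfl
  rw [h]
  refine MeasurableSet.biUnion (Set.to_countable _) (fun σ _ => ?_)
  simp only [Tuple.eq_sort_iff, Monotone, Function.comp_apply]
  measurability

end

/-! Adding Gumbel noise and ranking amounts to running the exponential mechanism `k` times without
replacement: the ranked list has the Plackett-Luce law with weights `exp (u y / b)`
(`gumbelNoise_topK_eq`). Privacy then becomes a statement about a finite distribution with explicit
product formula.

If the score changes `u y - u' y` all lie in an interval of length `a * b`, the probabilities of
each single draw change by a factor of at most `exp a`, whatever set is left
(`Finset.div_sum_le_exp_mul`). With `b = Δ / ε`, sensitivity alone gives the interval `[-Δ, Δ]`, so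
`a = 2 * ε`; monotonicity puts all changes on one side of zero, so `a = ε`.

Composing the draws gives the factor `exp (k * a)` directly. For the advanced bound, the privacy
loss of one draw lies in `[-a, a]` and has mean at most `a * tanh (a / 2)`, so Hoeffding's lemma
bounds its moment generating function. These bounds multiply over the draws, and Markov's inequality
with the optimal exponent yields `sum_plackettLuce_le_composedEps`. -/

/-! ### Privacy loss of a single draw. -/

/-- Hoeffding's lemma for a finitely supported distribution. -/
theorem Finset.sum_mul_exp_sub_le {ι : Type*} (A : Finset ι) (p X : ι → ℝ) (a t : ℝ)
    (hp : ∀ i ∈ A, 0 ≤ p i) (hsum : ∑ i ∈ A, p i = 1) (ha : 0 ≤ a) (hX : ∀ i ∈ A, |X i| ≤ a) :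
    ∑ i ∈ A, p i * Real.exp (t * (X i - ∑ j ∈ A, p j * X j)) ≤ Real.exp (a ^ 2 * t ^ 2 / 2) := by
  let _ : MeasurableSpace ι := ⊤
  have _ : MeasurableSingletonClass ι := ⟨fun _ => trivial⟩
  let μ : Measure ι := ∑ i ∈ A, ENNReal.ofReal (p i) • Measure.dirac i
  have hint : ∀ f : ι → ℝ, ∫ x, f x ∂μ = ∑ i ∈ A, p i * f i := by
    intro f
    rw [integral_finsetSum_measure (fun i _ =>
      (integrable_dirac (by simp)).smul_measure ENNReal.ofReal_ne_top)]
    refine Finset.sum_congr rfl fun i hi => ?_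
    rw [integral_smul_measure, integral_dirac, ENNReal.toReal_ofReal (hp i hi), smul_eq_mul]
  have hprob : IsProbabilityMeasure μ := by
    constructor
    simp only [μ, Measure.coe_finsetSum, Finset.sum_apply, Measure.smul_apply, measure_univ,
      smul_eq_mul, mul_one]
    rw [← ENNReal.ofReal_sum_of_nonneg hp, hsum, ENNReal.ofReal_one]
  have hb : ∀ᵐ i ∂μ, X i ∈ Set.Icc (-a) a := by
    rw [ae_iff]
    simp only [μ, Measure.coe_finsetSum, Finset.sum_apply, Measure.smul_apply, smul_eq_mul]
    refine Finset.sum_eq_zero fun i hi => ?_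
    rw [Measure.dirac_apply, Set.indicator_of_notMem, mul_zero]
    simpa using abs_le.mp (hX i hi)
  -- The interval has length `2 * a`, so the variance proxy is `(2 * a / 2) ^ 2 = a ^ 2`.
  have h := (ProbabilityTheory.hasSubgaussianMGF_of_mem_Icc
    (measurable_from_top.aemeasurable : AEMeasurable X μ) hb).mgf_le t
  rw [ProbabilityTheory.mgf, hint, hint] at h
  refine h.trans_eq ?_
  congr 1
  have : |a - -a| = 2 * a := by rw [abs_of_nonneg] <;> linarith
  simp only [NNReal.coe_pow, NNReal.coe_div, coe_nnnorm, Real.norm_eq_abs, this]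
  norm_num

/-- The Kullback-Leibler divergence of two finite distributions whose ratio is at most `exp a`. -/
theorem Finset.sum_mul_log_div_le {ι : Type*} (A : Finset ι) (p q : ι → ℝ) {a : ℝ} (ha : 0 < a)
    (hp : ∀ i ∈ A, 0 < p i) (hq : ∀ i ∈ A, 0 < q i) (hps : ∑ i ∈ A, p i = 1)
    (hqs : ∑ i ∈ A, q i = 1) (hlog : ∀ i ∈ A, |Real.log (p i / q i)| ≤ a) :
    ∑ i ∈ A, p i * Real.log (p i / q i) ≤ a * ((Real.exp a - 1) / (Real.exp a + 1)) := by
  -- On `[-a, a]` the convex function `exp` lies below its chord. At `-x`, with `x` the log-ratio,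
  -- this bounds `q i / p i` by a function affine in `x`; summing against `p` isolates the
  -- divergence.
  have key : ∀ i ∈ A, q i * a ≤
      p i * (a * Real.cosh a) - p i * Real.log (p i / q i) * Real.sinh a := by
    intro i hi
    obtain ⟨h1, h2⟩ := abs_le.mp (hlog i hi)
    have hpi := hp i hi
    have hqi := hq i hi
    set x := Real.log (p i / q i) with hx
    have hexp : Real.exp (-x) = q i / p i := by
      rw [hx, Real.exp_neg, Real.exp_log (div_pos hpi hqi), inv_div]
    have hconv := convexOn_exp.2
    have hc := hconv (Set.mem_univ (-a)) (Set.mem_univ a)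
      (a := (a + x) / (2 * a)) (b := (a - x) / (2 * a))
      (div_nonneg (by linarith) (by linarith)) (div_nonneg (by linarith) (by linarith))
      (by field_simp; ring)
    simp only [smul_eq_mul] at hc
    rw [show (a + x) / (2 * a) * -a + (a - x) / (2 * a) * a = -x by field_simp; ring, hexp,
      div_le_iff₀ hpi] at hc
    calc q i * a ≤ _ := mul_le_mul_of_nonneg_right hc ha.le
      _ = _ := by rw [Real.cosh_eq, Real.sinh_eq]; field_simp; ring
  have hsum := Finset.sum_le_sum key
  rw [← Finset.sum_mul, Finset.sum_sub_distrib, ← Finset.sum_mul, ← Finset.sum_mul, hps, hqs]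
    at hsum
  have hs : 0 < Real.sinh a := Real.sinh_pos_iff.mpr ha
  refine le_of_mul_le_mul_right ?_ hs
  -- Both sides express `tanh (a / 2) = (cosh a - 1) / sinh a`.
  have hm : (Real.exp a - 1) / (Real.exp a + 1) * Real.sinh a = Real.cosh a - 1 := by
    have := Real.exp_pos a
    rw [Real.cosh_eq, Real.sinh_eq, Real.exp_neg]
    field_simp
    ring
  rw [mul_assoc, hm]
  linarith

/-- A bound on the moment generating function of the privacy loss of a single choice. -/
theorem Finset.sum_mul_div_rpow_le {ι : Type*} (A : Finset ι) (p q : ι → ℝ) {a t : ℝ} (ha : 0 < a)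
    (ht : 0 ≤ t) (hp : ∀ i ∈ A, 0 < p i) (hq : ∀ i ∈ A, 0 < q i) (hps : ∑ i ∈ A, p i = 1)
    (hqs : ∑ i ∈ A, q i = 1) (hpq : ∀ i ∈ A, p i ≤ Real.exp a * q i)
    (hqp : ∀ i ∈ A, q i ≤ Real.exp a * p i) :
    ∑ i ∈ A, p i * (p i / q i) ^ t ≤
      Real.exp (t * (a * ((Real.exp a - 1) / (Real.exp a + 1))) + a ^ 2 * t ^ 2 / 2) := by
  have hlog : ∀ i ∈ A, |Real.log (p i / q i)| ≤ a := by
    intro i hi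
    have hpi := hp i hi
    have hqi := hq i hi
    rw [abs_le]
    constructor
    · rw [Real.le_log_iff_exp_le (div_pos hpi hqi), le_div_iff₀ hqi, Real.exp_neg,
        inv_mul_le_iff₀ (Real.exp_pos a)]
      exact hqp i hi
    · rw [Real.log_le_iff_le_exp (div_pos hpi hqi), div_le_iff₀ hqi]
      exact hpq i hi
  have h1 := A.sum_mul_exp_sub_le p (fun i => Real.log (p i / q i)) a t (fun i hi => (hp i hi).le)
    hps ha.le hlog
  have h2 := A.sum_mul_log_div_le p q ha hp hq hps hqs hlog
  set m := ∑ i ∈ A, p i * Real.log (p i / q i)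
  calc ∑ i ∈ A, p i * (p i / q i) ^ t
      = Real.exp (t * m) * ∑ i ∈ A, p i * Real.exp (t * (Real.log (p i / q i) - m)) := by
        rw [Finset.mul_sum]
        refine Finset.sum_congr rfl fun i hi => ?_
        rw [Real.rpow_def_of_pos (div_pos (hp i hi) (hq i hi)), mul_left_comm, ← Real.exp_add]
        ring_nf
    _ ≤ Real.exp (t * (a * ((Real.exp a - 1) / (Real.exp a + 1)))) *
          Real.exp (a ^ 2 * t ^ 2 / 2) :=
        mul_le_mul (Real.exp_le_exp.mpr (mul_le_mul_of_nonneg_left h2 ht)) h1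
          (Finset.sum_nonneg fun i hi => mul_nonneg (hp i hi).le (Real.exp_pos _).le)
          (Real.exp_pos _).le
    _ = _ := (Real.exp_add _ _).symm

/-! ### Composition for draws without replacement. -/

section PlackettLuce

variable {Y : Type*} [DecidableEq Y]

/-- The Plackett-Luce probability of drawing the list `o` from `A` without replacement, where each
element is drawn with probability proportional to its weight. -/
noncomputable def plackettLuce (w : Y → ℝ) : (k : ℕ) → Finset Y → (Fin k → Y) → ℝ
  | 0, _, _ => 1
  | k + 1, A, o => if o 0 ∈ A then
      w (o 0) / (∑ y ∈ A, w y) * plackettLuce w k (A.erase (o 0)) (Fin.tail o) else 0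

theorem plackettLuce_cons {w : Y → ℝ} {k : ℕ} {A : Finset Y} {y : Y} (hy : y ∈ A)
    (o : Fin k → Y) : plackettLuce w (k + 1) A (Fin.cons y o : Fin (k + 1) → Y) =
      w y / (∑ y ∈ A, w y) * plackettLuce w k (A.erase y) o := by
  simp [plackettLuce, hy]

theorem plackettLuce_nonneg {w : Y → ℝ} (hw : ∀ y, 0 < w y) (k : ℕ) (A : Finset Y)
    (o : Fin k → Y) : 0 ≤ plackettLuce w k A o := by
  induction k generalizing A with
  | zero => simp [plackettLuce]
  | succ k ih =>
    rw [plackettLuce]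
    split_ifs
    · exact mul_nonneg (div_nonneg (hw _).le (Finset.sum_nonneg fun y _ => (hw y).le)) (ih _ _)
    · exact le_rfl

theorem plackettLuce_le {w w' : Y → ℝ} (hw : ∀ y, 0 < w y) (hw' : ∀ y, 0 < w' y) {a : ℝ}
    (h : ∀ A : Finset Y, ∀ y ∈ A, w y / (∑ y ∈ A, w y) ≤ Real.exp a * (w' y / ∑ y ∈ A, w' y))
    (k : ℕ) (A : Finset Y) (o : Fin k → Y) :
    plackettLuce w k A o ≤ Real.exp (k * a) * plackettLuce w' k A o := by
  induction k generalizing A with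
  | zero => simp [plackettLuce]
  | succ k ih =>
    rw [plackettLuce, plackettLuce]
    split_ifs with hA
    · calc _ ≤ (Real.exp a * (w' (o 0) / ∑ y ∈ A, w' y)) * (Real.exp (k * a) *
            plackettLuce w' k (A.erase (o 0)) (Fin.tail o)) :=
          mul_le_mul (h A _ hA) (ih _ _) (plackettLuce_nonneg hw _ _ _)
            (mul_nonneg (Real.exp_pos _).le
              (div_nonneg (hw' _).le (Finset.sum_nonneg fun y _ => (hw' y).le)))
        _ = _ := by rw [Nat.cast_succ, add_mul, one_mul, Real.exp_add]; ring
    · simp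

variable [Fintype Y]

theorem sum_plackettLuce_succ_mul (w : Y → ℝ) {k : ℕ} (A : Finset Y)
    (G : (Fin (k + 1) → Y) → ℝ) :
    ∑ o, plackettLuce w (k + 1) A o * G o = ∑ y ∈ A, w y / (∑ y ∈ A, w y) *
      ∑ o, plackettLuce w k (A.erase y) o * G (Fin.cons y o : Fin (k + 1) → Y) := by
  rw [← (Fin.consEquiv fun _ : Fin (k + 1) => Y).sum_comp, Fintype.sum_prod_type,
    ← Finset.sum_subset (Finset.subset_univ A)]
  · refine Finset.sum_congr rfl fun y hy => ?_
    rw [Finset.mul_sum]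
    refine Finset.sum_congr rfl fun o _ => ?_
    change plackettLuce w (k + 1) A (Fin.cons y o) * _ = _
    rw [plackettLuce_cons hy, mul_assoc]
    rfl
  · intro y _ hy
    refine Finset.sum_eq_zero fun o _ => ?_
    simp [plackettLuce, hy]

theorem sum_plackettLuce {w : Y → ℝ} (hw : ∀ y, 0 < w y) {k : ℕ} {A : Finset Y}
    (hk : k ≤ A.card) : ∑ o, plackettLuce w k A o = 1 := by
  induction k generalizing A with
  | zero => simp [plackettLuce]
  | succ k ih =>
    have hA : A.Nonempty := Finset.card_pos.mp (by omega)
    have h := sum_plackettLuce_succ_mul w (k := k) A (fun _ => 1)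
    simp only [mul_one] at h
    rw [h, Finset.sum_congr rfl fun y hy => by
      rw [ih (by rw [Finset.card_erase_of_mem hy]; omega), mul_one], ← Finset.sum_div,
      div_self (Finset.sum_pos (fun y _ => hw y) hA).ne']

/-- The likelihood ratio factors into the ratio of the first draw and that of the remaining list.
The bound for the latter does not depend on which element was removed, so it comes out of the sum
and the exponents add up. -/
theorem sum_plackettLuce_mul_rpow_le {w w' : Y → ℝ} (hw : ∀ y, 0 < w y) (hw' : ∀ y, 0 < w' y)
    {a t : ℝ} (ha : 0 < a) (ht : 0 ≤ t)
    (h : ∀ A : Finset Y, ∀ y ∈ A, w y / (∑ y ∈ A, w y) ≤ Real.exp a * (w' y / ∑ y ∈ A, w' y))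
    (h' : ∀ A : Finset Y, ∀ y ∈ A, w' y / (∑ y ∈ A, w' y) ≤ Real.exp a * (w y / ∑ y ∈ A, w y))
    {k : ℕ} {A : Finset Y} (hk : k ≤ A.card) :
    ∑ o, plackettLuce w k A o * (plackettLuce w k A o / plackettLuce w' k A o) ^ t ≤
      Real.exp (k * (t * (a * ((Real.exp a - 1) / (Real.exp a + 1))) + a ^ 2 * t ^ 2 / 2)) := by
  induction k generalizing A with
  | zero => simp [plackettLuce]
  | succ k ih =>
    have hA : A.Nonempty := Finset.card_pos.mp (by omega)
    have hW := Finset.sum_pos (fun y _ => hw y) hA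
    have hW' := Finset.sum_pos (fun y _ => hw' y) hA
    have hstep := A.sum_mul_div_rpow_le (fun y => w y / ∑ y ∈ A, w y)
      (fun y => w' y / ∑ y ∈ A, w' y) ha ht (fun y _ => div_pos (hw y) hW)
      (fun y _ => div_pos (hw' y) hW') (by rw [← Finset.sum_div, div_self hW.ne'])
      (by rw [← Finset.sum_div, div_self hW'.ne']) (h A) (h' A)
    rw [sum_plackettLuce_succ_mul]
    set c := t * (a * ((Real.exp a - 1) / (Real.exp a + 1))) + a ^ 2 * t ^ 2 / 2
    calc _ ≤ ∑ y ∈ A, (w y / (∑ y ∈ A, w y) *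
            ((w y / (∑ y ∈ A, w y)) / (w' y / ∑ y ∈ A, w' y)) ^ t) * Real.exp (k * c) := by
          refine Finset.sum_le_sum fun y hy => ?_
          have hpos : 0 < w y / ∑ y ∈ A, w y := div_pos (hw y) hW
          have hpos' : 0 < w' y / ∑ y ∈ A, w' y := div_pos (hw' y) hW'
          rw [mul_assoc]
          refine mul_le_mul_of_nonneg_left ?_ hpos.le
          refine le_trans (le_of_eq ?_) (mul_le_mul_of_nonneg_left
            (ih (A := A.erase y) (by rw [Finset.card_erase_of_mem hy]; omega))
            (Real.rpow_nonneg (div_pos hpos hpos').le t))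
          rw [Finset.mul_sum]
          refine Finset.sum_congr rfl fun o _ => ?_
          rw [plackettLuce_cons hy, plackettLuce_cons hy, mul_div_mul_comm,
            Real.mul_rpow (div_pos hpos hpos').le
              (div_nonneg (plackettLuce_nonneg hw _ _ _) (plackettLuce_nonneg hw' _ _ _))]
          ring
      _ ≤ Real.exp c * Real.exp (k * c) := by
          rw [← Finset.sum_mul]
          gcongr
      _ = _ := by rw [← Real.exp_add]; push_cast; ring_nf

/-- The composition theorem for the Plackett-Luce distribution. -/
theorem sum_plackettLuce_le_composedEps {w w' : Y → ℝ} (hw : ∀ y, 0 < w y) (hw' : ∀ y, 0 < w' y)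
    {a δ : ℝ} (ha : 0 < a) (hδ : 0 ≤ δ)
    (h : ∀ A : Finset Y, ∀ y ∈ A, w y / (∑ y ∈ A, w y) ≤ Real.exp a * (w' y / ∑ y ∈ A, w' y))
    (h' : ∀ A : Finset Y, ∀ y ∈ A, w' y / (∑ y ∈ A, w' y) ≤ Real.exp a * (w y / ∑ y ∈ A, w y))
    {k : ℕ} {A : Finset Y} (hk : k ≤ A.card) (S : Finset (Fin k → Y)) :
    ∑ o ∈ S, plackettLuce w k A o ≤
      Real.exp (composedEps k a δ) * ∑ o ∈ S, plackettLuce w' k A o + δ := by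
  have hP := plackettLuce_nonneg hw k A
  have hQ := plackettLuce_nonneg hw' k A
  have hQS : 0 ≤ ∑ o ∈ S, plackettLuce w' k A o := Finset.sum_nonneg fun o _ => hQ o
  have hbasic : ∑ o ∈ S, plackettLuce w k A o ≤
      Real.exp (k * a) * ∑ o ∈ S, plackettLuce w' k A o + δ := by
    rw [Finset.mul_sum]
    have := Finset.sum_le_sum fun o (_ : o ∈ S) => plackettLuce_le hw hw' h k A o
    linarith
  rw [composedEps]
  split_ifs with hδ0
  · exact hbasic
  -- For `δ ≥ 1` the claim is trivial, as the left side is at most `1`.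
  rcases le_or_gt 1 δ with hδ1 | hδ1
  · have h1 : ∑ o ∈ S, plackettLuce w k A o ≤ 1 :=
      (Finset.sum_le_univ_sum_of_nonneg hP).trans_eq (sum_plackettLuce hw hk)
    have := mul_nonneg (Real.exp_pos (min (k * a) (k * a * ((Real.exp a - 1) / (Real.exp a + 1)) +
      a * Real.sqrt (2 * k * Real.log (1 / δ))))).le hQS
    linarith
  rcases min_choice ((k : ℝ) * a) (k * a * ((Real.exp a - 1) / (Real.exp a + 1)) +
    a * Real.sqrt (2 * k * Real.log (1 / δ))) with hmin | hmin
  · rwa [hmin]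
  rw [hmin]
  rcases Nat.eq_zero_or_pos k with rfl | hkpos
  · simpa using hbasic
  have hδpos : 0 < δ := lt_of_le_of_ne hδ (Ne.symm hδ0)
  have hkR : (0 : ℝ) < k := by exact_mod_cast hkpos
  have hL : 0 < Real.log (1 / δ) := Real.log_pos (by rw [lt_div_iff₀ hδpos]; linarith)
  set s := Real.sqrt (2 * k * Real.log (1 / δ)) with hs
  have hs2 : s ^ 2 = 2 * k * Real.log (1 / δ) := Real.sq_sqrt (by positivity)
  have hs0 : 0 ≤ s := Real.sqrt_nonneg _
  set m := (Real.exp a - 1) / (Real.exp a + 1)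
  -- This `t` minimizes the Chernoff exponent `-t * a * s + k * a ^ 2 * t ^ 2 / 2`; the minimum `-s
  -- ^ 2 / (2 * k)` equals `log δ`.
  set t := s / (k * a) with htdef
  have ht : 0 ≤ t := by positivity
  set ε' := k * a * m + a * s
  -- Markov's inequality, pointwise: wherever the ratio exceeds `exp ε'`, the moment term alone
  -- dominates the probability.
  have hpt : ∀ o, plackettLuce w k A o ≤ Real.exp ε' * plackettLuce w' k A o +
      Real.exp (-(t * ε')) *
        (plackettLuce w k A o * (plackettLuce w k A o / plackettLuce w' k A o) ^ t) := by
    intro o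
    have hPo := hP o
    have hQo := hQ o
    set P := plackettLuce w k A o
    set Q := plackettLuce w' k A o
    rcases le_or_gt P (Real.exp ε' * Q) with hle | hlt
    · have : 0 ≤ Real.exp (-(t * ε')) * (P * (P / Q) ^ t) := by positivity
      linarith
    -- The basic bound excludes a zero denominator, since `Q = 0` would force `P = 0`.
    · have hQpos : 0 < Q := by
        refine lt_of_le_of_ne hQo fun h0 => ?_
        have := plackettLuce_le hw hw' h k A o
        change P ≤ Real.exp (k * a) * Q at this
        rw [← h0, mul_zero] at this hlt
        linarith
      have h1 : Real.exp (t * ε') ≤ (P / Q) ^ t := by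
        rw [mul_comm, Real.exp_mul]
        exact Real.rpow_le_rpow (Real.exp_pos _).le ((le_div_iff₀ hQpos).mpr hlt.le) ht
      have h2 : P ≤ Real.exp (-(t * ε')) * (P * (P / Q) ^ t) := by
        calc P = Real.exp (-(t * ε')) * (P * Real.exp (t * ε')) := by
              rw [mul_left_comm, ← Real.exp_add]; simp
          _ ≤ _ := by gcongr
      have : 0 ≤ Real.exp ε' * Q := by positivity
      linarith
  have hmgf := sum_plackettLuce_mul_rpow_le hw hw' ha ht h h' hk
  have hexp : Real.exp (-(t * ε')) * Real.exp (k * (t * (a * m) + a ^ 2 * t ^ 2 / 2)) = δ := by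
    rw [← Real.exp_add]
    have : -(t * ε') + k * (t * (a * m) + a ^ 2 * t ^ 2 / 2) = Real.log δ := by
      have hlog : Real.log δ = -(s ^ 2 / (2 * k)) := by
        rw [hs2, one_div, Real.log_inv]; field_simp
      rw [hlog, htdef]
      simp only [ε']
      field_simp
      ring
    rw [this, Real.exp_log hδpos]
  calc ∑ o ∈ S, plackettLuce w k A o
      ≤ ∑ o ∈ S, (Real.exp ε' * plackettLuce w' k A o + Real.exp (-(t * ε')) *
          (plackettLuce w k A o * (plackettLuce w k A o / plackettLuce w' k A o) ^ t)) :=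
        Finset.sum_le_sum fun o _ => hpt o
    _ = Real.exp ε' * ∑ o ∈ S, plackettLuce w' k A o + Real.exp (-(t * ε')) * ∑ o ∈ S,
          (plackettLuce w k A o * (plackettLuce w k A o / plackettLuce w' k A o) ^ t) := by
        rw [Finset.sum_add_distrib, Finset.mul_sum, Finset.mul_sum]
    _ ≤ Real.exp ε' * ∑ o ∈ S, plackettLuce w' k A o + Real.exp (-(t * ε')) *
          Real.exp (k * (t * (a * m) + a ^ 2 * t ^ 2 / 2)) := by
        gcongr
        refine (Finset.sum_le_univ_sum_of_nonneg fun o => ?_).trans hmgf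
        exact mul_nonneg (hP o) (Real.rpow_nonneg (div_nonneg (hP o) (hQ o)) t)
    _ = _ := by rw [hexp]

end PlackettLuce

/-- If all weights change by factors within a range of width `exp a`, then the probabilities
proportional to the weights change by a factor of at most `exp a`. -/
theorem Finset.div_sum_le_exp_mul {ι : Type*} {w w' : ι → ℝ}
    (hw' : ∀ i, 0 < w' i) {l u : ℝ} (hl : ∀ i, Real.exp l * w' i ≤ w i)
    (hu : ∀ i, w i ≤ Real.exp u * w' i) (A : Finset ι) (i : ι) (hi : i ∈ A) :
    w i / (∑ j ∈ A, w j) ≤ Real.exp (u - l) * (w' i / ∑ j ∈ A, w' j) := by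
  have hW : 0 < ∑ j ∈ A, w' j := Finset.sum_pos (fun j _ => hw' j) ⟨i, hi⟩
  calc w i / (∑ j ∈ A, w j) ≤ (Real.exp u * w' i) / (Real.exp l * ∑ j ∈ A, w' j) := by
        refine div_le_div₀ (mul_pos (Real.exp_pos _) (hw' i)).le (hu i)
          (mul_pos (Real.exp_pos _) hW) ?_
        rw [Finset.mul_sum]
        exact Finset.sum_le_sum fun j _ => hl j
    _ = _ := by rw [Real.exp_sub, mul_div_mul_comm]

/-! ### Gumbel integrals. -/

theorem integrable_gumbelPDF {b : ℝ} (hb : 0 < b) : Integrable (gumbelPDF b) := by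
  have hn : ∀ z, 0 ≤ gumbelPDF b z := fun z => by unfold gumbelPDF; positivity
  have hc : Continuous (gumbelPDF b) := by unfold gumbelPDF; fun_prop
  have h := (isProbabilityMeasure_gumbelMeasure hb).measure_univ
  rw [gumbelMeasure, withDensity_apply _ MeasurableSet.univ, Measure.restrict_univ] at h
  refine ⟨hc.aestronglyMeasurable, ?_⟩
  rw [hasFiniteIntegral_iff_ofReal (Filter.Eventually.of_forall hn), h]
  exact ENNReal.one_lt_top

/-- A Laplace-type integral of the Gumbel distribution over a half-line. -/
theorem setLIntegral_Iio_gumbelMeasure {b : ℝ} (hb : 0 < b) {c : ℝ} (hc : 0 ≤ c) (r : ℝ) :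
    ∫⁻ z in Set.Iio r, ENNReal.ofReal (Real.exp (-(c * Real.exp (-(z / b))))) ∂gumbelMeasure b =
      ENNReal.ofReal (1 / (1 + c) * Real.exp (-((1 + c) * Real.exp (-(r / b))))) := by
  have hc1 : 0 < 1 + c := by linarith
  have hcont : Continuous (gumbelPDF b) := by unfold gumbelPDF; fun_prop
  have hn : ∀ z, 0 ≤ gumbelPDF b z := fun z => by unfold gumbelPDF; positivity
  set f : ℝ → ℝ := fun z => gumbelPDF b z * Real.exp (-(c * Real.exp (-(z / b)))) with hf
  -- An explicit antiderivative of `f` that vanishes at `-∞`.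
  set F : ℝ → ℝ := fun z => 1 / (1 + c) * Real.exp (-((1 + c) * Real.exp (-(z / b)))) with hF
  have hd : ∀ z : ℝ, HasDerivAt F (f z) z := by
    intro z
    have h1 : HasDerivAt (fun z : ℝ => -(z / b)) (-(1 / b)) z := ((hasDerivAt_id z).div_const b).neg
    have h2 := ((h1.exp.const_mul (1 + c)).neg.exp).const_mul (1 / (1 + c))
    refine h2.congr_deriv ?_
    simp only [hf, gumbelPDF, Pi.neg_apply]
    rw [mul_assoc (1 / b), ← Real.exp_add,
      show -(z / b + Real.exp (-(z / b))) + -(c * Real.exp (-(z / b))) =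
        -((1 + c) * Real.exp (-(z / b))) + -(z / b) by ring, Real.exp_add]
    field_simp
  have hfn : ∀ z, 0 ≤ f z := fun z => mul_nonneg (hn z) (Real.exp_pos _).le
  have hint : Integrable f := by
    refine (integrable_gumbelPDF hb).mono (by
      have : Continuous f := by fun_prop
      exact this.aestronglyMeasurable) (Filter.Eventually.of_forall fun z => ?_)
    rw [Real.norm_of_nonneg (hfn z), Real.norm_of_nonneg (hn z)]
    refine mul_le_of_le_one_right (hn z) (Real.exp_le_one_iff.mpr ?_)
    have := Real.exp_pos (-(z / b))
    nlinarith
  have hbot : Filter.Tendsto F Filter.atBot (nhds 0) := by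
    have : Filter.Tendsto (fun z => Real.exp (-((1 + c) * Real.exp (-(z / b))))) Filter.atBot
        (nhds 0) := by
      refine Real.tendsto_exp_atBot.comp (Filter.tendsto_neg_atTop_atBot.comp
        (Filter.Tendsto.const_mul_atTop hc1
        (Real.tendsto_exp_atTop.comp (Filter.tendsto_neg_atBot_atTop.comp ?_))))
      exact Filter.tendsto_id.atBot_div_const hb
    simpa [hF] using this.const_mul (1 / (1 + c))
  rw [gumbelMeasure, restrict_withDensity measurableSet_Iio,
    lintegral_withDensity_eq_lintegral_mul _ (by fun_prop) (by fun_prop)]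
  simp only [Pi.mul_apply, ← ENNReal.ofReal_mul (hn _)]
  rw [← ofReal_integral_eq_lintegral_ofReal hint.integrableOn
    (Filter.Eventually.of_forall hfn), ← integral_Iic_eq_integral_Iio,
    integral_Iic_of_hasDerivAt_of_tendsto' (fun z _ => hd z) hint.integrableOn hbot, sub_zero]

/-! ### The probability of a given strict ranking. -/

section RaceEvent

variable {Y : Type*} [DecidableEq Y]

/-- All values of `v` on `A` are below `s`, and the list `o` consists of the elements of `A` with
the largest values in strictly decreasing order. -/
def rankedBelow (v : Y → ℝ) : (k : ℕ) → Finset Y → ℝ → (Fin k → Y) → Prop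
  | 0, A, s, _ => ∀ y ∈ A, v y < s
  | k + 1, A, s, o => o 0 ∈ A ∧ v (o 0) < s ∧
      rankedBelow v k (A.erase (o 0)) (v (o 0)) (Fin.tail o)

theorem rankedBelow.lt {v : Y → ℝ} {k : ℕ} {A : Finset Y} {s : ℝ} {o : Fin k → Y}
    (h : rankedBelow v k A s o) {y : Y} (hy : y ∈ A) : v y < s := by
  induction k generalizing A s with
  | zero => exact h y hy
  | succ k ih =>
    by_cases hyo : y = o 0
    · exact hyo ▸ h.2.1
    · exact (ih h.2.2 (Finset.mem_erase.mpr ⟨hyo, hy⟩)).trans h.2.1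

theorem rankedBelow.mem {v : Y → ℝ} {k : ℕ} {A : Finset Y} {s : ℝ} {o : Fin k → Y}
    (h : rankedBelow v k A s o) (j : Fin k) : o j ∈ A := by
  induction k generalizing A s with
  | zero => exact j.elim0
  | succ k ih =>
    refine Fin.cases h.1 (fun i => ?_) j
    exact Finset.mem_of_mem_erase (ih h.2.2 i)

theorem rankedBelow.injective {v : Y → ℝ} {k : ℕ} {A : Finset Y} {s : ℝ} {o : Fin k → Y}
    (h : rankedBelow v k A s o) : Function.Injective o := by
  induction k generalizing A s with
  | zero => exact fun i => i.elim0
  | succ k ih =>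
    rw [← Fin.cons_self_tail o, Fin.cons_injective_iff]
    refine ⟨?_, ih h.2.2⟩
    rintro ⟨i, hi⟩
    exact (Finset.mem_erase.mp (h.2.2.mem i)).1 hi

theorem rankedBelow.lt_of_forall_ne {v : Y → ℝ} {k : ℕ} {A : Finset Y} {s : ℝ} {o : Fin k → Y}
    (h : rankedBelow v k A s o) (j : Fin k) {y : Y} (hy : y ∈ A) (hne : ∀ i ≤ j, y ≠ o i) :
    v y < v (o j) := by
  induction k generalizing A s with
  | zero => exact j.elim0
  | succ k ih =>
    have hy' : y ∈ A.erase (o 0) := Finset.mem_erase.mpr ⟨hne 0 (Fin.zero_le j), hy⟩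
    induction j using Fin.cases with
    | zero => exact h.2.2.lt hy'
    | succ j => exact ih h.2.2 j hy' fun i hi => hne i.succ (Fin.succ_le_succ_iff.mpr hi)

/-- By strong induction on the rank `n`, the sorted position `m` of `o n` must be `n`. An earlier
position already holds another entry of the injective list `o`. If `m` were later, the element at
position `n` would have a value strictly below that of `o n`, against the sorting. -/
theorem rankedBelow.topK_eq [Fintype Y] {d k : ℕ} (e : Fin d ≃ Y) (hk : k ≤ d) {v : Y → ℝ} {s : ℝ}
    {o : Fin k → Y} (h : rankedBelow v k Finset.univ s o) : topK e hk v = o := by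
  set σ := Tuple.sort (fun i : Fin d => -v (e i)) with hσ
  have hmono : ∀ i j, i ≤ j → v (e (σ j)) ≤ v (e (σ i)) := fun i j hij =>
    neg_le_neg_iff.mp (Tuple.monotone_sort (fun i : Fin d => -v (e i)) hij)
  have key : ∀ n (hn : n < k), e (σ (Fin.castLE hk ⟨n, hn⟩)) = o ⟨n, hn⟩ := by
    intro n
    induction n using Nat.strong_induction_on with
    | _ n ih =>
      intro hn
      obtain ⟨m, hm⟩ := (σ.trans e).surjective (o ⟨n, hn⟩)
      simp only [Equiv.trans_apply] at hm
      rcases lt_trichotomy m.val n with hlt | heq | hgt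
      · have h1 := ih m hlt (hlt.trans hn)
        have h2 : Fin.castLE hk ⟨m, hlt.trans hn⟩ = m := rfl
        rw [h2, hm] at h1
        have := congrArg Fin.val (h.injective h1)
        simp only at this
        omega
      · rw [← hm]
        congr 2
        exact Fin.ext heq.symm
      · exfalso
        have h1 : v (e (σ (Fin.castLE hk ⟨n, hn⟩))) < v (o ⟨n, hn⟩) := by
          refine h.lt_of_forall_ne _ (Finset.mem_univ _) fun i hi heq => ?_
          have hi' : i.val ≤ n := hi
          rcases hi'.lt_or_eq with hin | hin
          · have h3 := ih i hin i.isLt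
            rw [Fin.eta, ← heq] at h3
            have := congrArg Fin.val (σ.injective (e.injective h3))
            simp only [Fin.val_castLE] at this
            omega
          · rw [show i = ⟨n, hn⟩ from Fin.ext hin, ← hm] at heq
            have := congrArg Fin.val (σ.injective (e.injective heq))
            simp only [Fin.val_castLE] at this
            omega
        have h2 := hmono (Fin.castLE hk ⟨n, hn⟩) m hgt.le
        rw [hm] at h2
        exact absurd h1 (not_lt.mpr h2)
  funext j
  exact key j j.isLt

/-- The threshold may depend on the noise because the recursion replaces it by the noisy score of
the element just ranked. -/
theorem measurableSet_rankedBelow [Countable Y] (u : Y → ℝ) (k : ℕ) (A : Finset Y)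
    (o : Fin k → Y) {c : (Y → ℝ) → ℝ} (hc : Measurable c) :
    MeasurableSet {z : Y → ℝ | rankedBelow (u + z) k A (c z) o} := by
  induction k generalizing A c with
  | zero =>
    simp only [rankedBelow, Pi.add_apply]
    have : {z : Y → ℝ | ∀ y ∈ A, u y + z y < c z} = ⋂ y ∈ A, {z | u y + z y < c z} := by
      ext; simp
    rw [this]
    exact Finset.measurableSet_biInter _ fun y _ => measurableSet_lt (by fun_prop) hc
  | succ k ih =>
    simp only [rankedBelow]
    refine (MeasurableSet.const _).inter (MeasurableSet.inter ?_ (ih _ _ ?_))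
    · exact measurableSet_lt (by simp only [Pi.add_apply]; fun_prop) hc
    · simp only [Pi.add_apply]; fun_prop

/-- Integrating out one coordinate that is known to be below a threshold. -/
theorem lmarginal_indicator_and_lt {b : ℝ} (hb : 0 < b) (u : Y → ℝ) (A : Finset Y) {y : Y}
    (hy : y ∈ A) (s : ℝ) (E : ℝ → Set (Y → ℝ)) (hE : MeasurableSet {z | z ∈ E (u y + z y)})
    {C : ℝ} (hC : 0 ≤ C)
    (h : ∀ t x, lmarginal (fun _ => gumbelMeasure b) (A.erase y) ((E t).indicator 1) x =
      ENNReal.ofReal (Real.exp (-((∑ i ∈ A.erase y, Real.exp (u i / b)) * Real.exp (-(t / b)))) * C))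
    (x : Y → ℝ) :
    lmarginal (fun _ => gumbelMeasure b) A
        ({z | u y + z y < s ∧ z ∈ E (u y + z y)}.indicator 1) x =
      ENNReal.ofReal (Real.exp (-((∑ i ∈ A, Real.exp (u i / b)) * Real.exp (-(s / b)))) *
        (Real.exp (u y / b) / (∑ i ∈ A, Real.exp (u i / b)) * C)) := by
  have := isProbabilityMeasure_gumbelMeasure hb
  classical
  have hmeas : MeasurableSet {z : Y → ℝ | u y + z y < s ∧ z ∈ E (u y + z y)} :=
    MeasurableSet.inter (s₁ := {z : Y → ℝ | u y + z y < s})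
      (measurableSet_lt (by fun_prop) measurable_const) hE
  rw [lmarginal_erase (μ := fun _ : Y => gumbelMeasure b) _ (measurable_one.indicator hmeas) hy]
  set w := Real.exp (u y / b) with hw
  set W := ∑ i ∈ A.erase y, Real.exp (u i / b) with hWdef
  have hsum : ∑ i ∈ A, Real.exp (u i / b) = w + W := (Finset.add_sum_erase A _ hy).symm
  have hwpos : 0 < w := Real.exp_pos _
  have hW : 0 ≤ W := Finset.sum_nonneg fun i _ => (Real.exp_pos _).le
  -- Once coordinate `y` is frozen at `t`, the remaining integral is `h` with threshold `u y + t`,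
  -- or zero when this is not below `s`.
  have hinner : ∀ t : ℝ, lmarginal (fun _ => gumbelMeasure b) (A.erase y)
      ({z | u y + z y < s ∧ z ∈ E (u y + z y)}.indicator 1) (Function.update x y t) =
      (Set.Iio (s - u y)).indicator (fun t =>
        ENNReal.ofReal C * ENNReal.ofReal (Real.exp (-(W / w * Real.exp (-(t / b)))))) t := by
    intro t
    have hcoord : ∀ z : (i : (A.erase y : Finset Y)) → ℝ,
        Function.updateFinset (Function.update x y t) (A.erase y) z y = t := by
      intro z
      simp [Function.updateFinset]
    by_cases ht : t < s - u y
    · rw [Set.indicator_of_mem (by exact ht), ← ENNReal.ofReal_mul hC]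
      have hval := h (u y + t) (Function.update x y t)
      have hexp : W * Real.exp (-((u y + t) / b)) = W / w * Real.exp (-(t / b)) := by
        rw [hw, add_div, neg_add, Real.exp_add, Real.exp_neg (u y / b)]
        field_simp
      rw [hexp, mul_comm _ C] at hval
      rw [← hval]
      unfold lmarginal
      refine lintegral_congr fun z => ?_
      have hlt : u y + t < s := by linarith
      simp only [Set.indicator_apply, Set.mem_ofPred_eq, hcoord, hlt, true_and]
    · rw [Set.indicator_of_notMem (by exact ht)]
      unfold lmarginal
      rw [lintegral_eq_zero_of_ae_eq_zero]
      refine Filter.Eventually.of_forall fun z => ?_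
      have hlt : ¬ u y + t < s := fun hlt => ht (by linarith)
      simp only [Set.indicator_apply, Set.mem_ofPred_eq, hcoord, hlt, false_and, if_false,
        Pi.zero_apply]
  simp only [hinner]
  rw [lintegral_indicator measurableSet_Iio, lintegral_const_mul _ (by fun_prop),
    setLIntegral_Iio_gumbelMeasure hb (div_nonneg hW hwpos.le), ← ENNReal.ofReal_mul hC, hsum]
  congr 1
  -- The normalizing factor of the Gumbel integral is exactly the probability of drawing `y` first.
  have h1 : 1 / (1 + W / w) = w / (w + W) := by field_simp
  have h2 : (1 + W / w) * Real.exp (-((s - u y) / b)) = (w + W) * Real.exp (-(s / b)) := by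
    rw [show -((s - u y) / b) = -(s / b) + u y / b by ring, Real.exp_add, ← hw]
    field_simp
  rw [h1, h2]
  ring

theorem lmarginal_forall_lt {b : ℝ} (hb : 0 < b) (u : Y → ℝ) (A : Finset Y) (s : ℝ)
    (x : Y → ℝ) :
    lmarginal (fun _ => gumbelMeasure b) A ({z | ∀ y ∈ A, u y + z y < s}.indicator 1) x =
      ENNReal.ofReal (Real.exp (-((∑ i ∈ A, Real.exp (u i / b)) * Real.exp (-(s / b))))) := by
  have := isProbabilityMeasure_gumbelMeasure hb
  have hIio : ∀ i, gumbelMeasure b (Set.Iio (s - u i)) =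
      ENNReal.ofReal (Real.exp (-(Real.exp (u i / b) * Real.exp (-(s / b))))) := by
    intro i
    have h := setLIntegral_Iio_gumbelMeasure hb le_rfl (s - u i)
    simp only [zero_mul, neg_zero, Real.exp_zero, ENNReal.ofReal_one, add_zero, div_one, one_mul,
      setLIntegral_one] at h
    rw [h, ← Real.exp_add]
    ring_nf
  have hbox : ∀ z : (i : A) → ℝ, ({z | ∀ y ∈ A, u y + z y < s}.indicator 1 :
      (Y → ℝ) → ENNReal) (Function.updateFinset x A z) =
      (Set.univ.pi fun i : A => Set.Iio (s - u i)).indicator 1 z := by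
    classical
    intro z
    simp only [Set.indicator_apply]
    refine if_congr ?_ rfl rfl
    simp only [Set.mem_ofPred_eq, Set.mem_pi, Set.mem_univ, forall_const, Set.mem_Iio,
      Subtype.forall, Function.updateFinset]
    refine forall₂_congr fun y hy => ?_
    rw [dif_pos hy, lt_sub_iff_add_lt']
  unfold lmarginal
  simp only [hbox]
  rw [lintegral_indicator_one (MeasurableSet.univ_pi fun _ => measurableSet_Iio), Measure.pi_pi]
  simp only [hIio]
  rw [← ENNReal.ofReal_prod_of_nonneg fun _ _ => (Real.exp_pos _).le, ← Real.exp_sum,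
    Finset.sum_neg_distrib, ← Finset.sum_mul,
    Finset.sum_coe_sort A fun i => Real.exp (u i / b)]

/-- The maximum of Gumbel-perturbed scores is independent of the element attaining it. Hence the
threshold enters only through the probability that all values lie below `s`, and the Plackett-Luce
factor passes through each integration as a constant. -/
theorem lmarginal_rankedBelow [Countable Y] {b : ℝ} (hb : 0 < b) (u : Y → ℝ) (k : ℕ)
    (A : Finset Y) (s : ℝ) (o : Fin k → Y) (x : Y → ℝ) :
    lmarginal (fun _ => gumbelMeasure b) A ({z | rankedBelow (u + z) k A s o}.indicator 1) x =
      ENNReal.ofReal (Real.exp (-((∑ i ∈ A, Real.exp (u i / b)) * Real.exp (-(s / b)))) *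
        plackettLuce (fun y => Real.exp (u y / b)) k A o) := by
  induction k generalizing A s x with
  | zero => simpa [rankedBelow, plackettLuce] using lmarginal_forall_lt hb u A s x
  | succ k ih =>
    by_cases ho : o 0 ∈ A
    · have h := lmarginal_indicator_and_lt hb u A ho s
        (fun t => {z | rankedBelow (u + z) k (A.erase (o 0)) t (Fin.tail o)})
        (measurableSet_rankedBelow u k _ _ (by fun_prop))
        (plackettLuce_nonneg (fun _ => Real.exp_pos _) k (A.erase (o 0)) (Fin.tail o))
        (fun t x => ih (A.erase (o 0)) t (Fin.tail o) x) x
      simpa [rankedBelow, plackettLuce, ho] using h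
    · simp [rankedBelow, plackettLuce, ho, lmarginal]

end RaceEvent

/-! ### The law of the noisy ranked list. -/

theorem isProbabilityMeasure_gumbelNoise (Y : Type*) [Fintype Y] {b : ℝ} (hb : 0 < b) :
    IsProbabilityMeasure (gumbelNoise Y b) := by
  have := isProbabilityMeasure_gumbelMeasure hb
  unfold gumbelNoise
  infer_instance

theorem measurableSet_topK_add_mem {Y : Type*} [Fintype Y] {d k : ℕ} (e : Fin d ≃ Y)
    (hk : k ≤ d) (u : Y → ℝ)
    (S : Set (Fin k → Y)) : MeasurableSet {z | topK e hk (u + z) ∈ S} :=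
  (measurable_const_add u) (measurableSet_topK_mem e hk S)

theorem gumbelNoise_topK_mem {Y : Type*} [Fintype Y] {d k : ℕ} (e : Fin d ≃ Y) (hk : k ≤ d)
    (b : ℝ) (u : Y → ℝ) (S : Finset (Fin k → Y)) :
    gumbelNoise Y b {z | topK e hk (u + z) ∈ S} =
      ∑ o ∈ S, gumbelNoise Y b {z | topK e hk (u + z) = o} := by
  have h : {z | topK e hk (u + z) ∈ S} = ⋃ o ∈ S, {z | topK e hk (u + z) = o} := by
    ext z; simp
  rw [h, measure_biUnion_finset]
  · intro o _ o' _ hne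
    exact Set.disjoint_left.mpr fun z hz hz' => hne (hz.symm.trans hz')
  · exact fun o _ => measurableSet_topK_add_mem e hk u {o}

section NoisyTopK

variable {Y : Type*} [Fintype Y] [DecidableEq Y] {d k : ℕ}

/-- The strict ranking event below `s` is contained in the event that `o` is returned; let `s` tend
to infinity. An inequality suffices here, so ties need no analysis. -/
theorem plackettLuce_le_gumbelNoise_topK (e : Fin d ≃ Y) (hk : k ≤ d) {b : ℝ} (hb : 0 < b)
    (u : Y → ℝ) (o : Fin k → Y) :
    ENNReal.ofReal (plackettLuce (fun y => Real.exp (u y / b)) k Finset.univ o) ≤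
      gumbelNoise Y b {z | topK e hk (u + z) = o} := by
  have := isProbabilityMeasure_gumbelMeasure hb
  have hle : ∀ s : ℝ, ENNReal.ofReal (Real.exp (-((∑ i, Real.exp (u i / b)) *
      Real.exp (-(s / b)))) * plackettLuce (fun y => Real.exp (u y / b)) k Finset.univ o) ≤
      gumbelNoise Y b {z | topK e hk (u + z) = o} := by
    intro s
    rw [← lmarginal_rankedBelow hb u k Finset.univ s o 0, lmarginal_univ, lintegral_indicator_one
      (measurableSet_rankedBelow u k _ o measurable_const)]
    exact measure_mono fun z hz => hz.topK_eq e hk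
  have hlim : Filter.Tendsto (fun s : ℝ => Real.exp (-((∑ i, Real.exp (u i / b)) *
      Real.exp (-(s / b)))) * plackettLuce (fun y => Real.exp (u y / b)) k Finset.univ o)
      Filter.atTop (nhds (plackettLuce (fun y => Real.exp (u y / b)) k Finset.univ o)) := by
    have h : Filter.Tendsto (fun s : ℝ => Real.exp (-(s / b))) Filter.atTop (nhds 0) :=
      Real.tendsto_exp_atBot.comp (Filter.tendsto_neg_atTop_atBot.comp
        (Filter.tendsto_id.atTop_div_const hb))
    have h1 := (Real.continuous_exp.tendsto _).comp
      ((h.const_mul (∑ i, Real.exp (u i / b))).neg)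
    simpa using h1.mul_const (plackettLuce (fun y => Real.exp (u y / b)) k Finset.univ o)
  exact le_of_tendsto (ENNReal.tendsto_ofReal hlim) (Filter.Eventually.of_forall hle)

/-- The ranked list of the `k` largest scores with Gumbel noise has a Plackett-Luce distribution. -/
theorem gumbelNoise_topK_eq (e : Fin d ≃ Y) (hk : k ≤ d) {b : ℝ} (hb : 0 < b)
    (u : Y → ℝ) (o : Fin k → Y) :
    gumbelNoise Y b {z | topK e hk (u + z) = o} =
      ENNReal.ofReal (plackettLuce (fun y => Real.exp (u y / b)) k Finset.univ o) := by
  have := isProbabilityMeasure_gumbelNoise Y hb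
  have hw : ∀ y, 0 < Real.exp (u y / b) := fun y => Real.exp_pos _
  have hcard : k ≤ (Finset.univ : Finset Y).card := by
    rw [Finset.card_univ, ← Fintype.card_congr e, Fintype.card_fin]
    exact hk
  have hsum : ∑ o, ENNReal.ofReal (plackettLuce (fun y => Real.exp (u y / b)) k Finset.univ o) =
      ∑ o, gumbelNoise Y b {z | topK e hk (u + z) = o} := by
    rw [← ENNReal.ofReal_sum_of_nonneg fun o _ => plackettLuce_nonneg hw k _ o,
      sum_plackettLuce hw hcard, ← gumbelNoise_topK_mem e hk b u]
    simp
  have hle := plackettLuce_le_gumbelNoise_topK e hk hb u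
  -- Both families sum to `1`, so a strict inequality at one list would contradict the termwise
  -- bounds at all others.
  refine (hle o).antisymm' (not_lt.mp fun hlt => hsum.not_lt ?_)
  rw [← Finset.add_sum_erase _ _ (Finset.mem_univ o), ← Finset.add_sum_erase _ _ (Finset.mem_univ o)]
  exact ENNReal.add_lt_add_of_lt_of_le
    (ENNReal.sum_ne_top.mpr fun _ _ => ENNReal.ofReal_ne_top) hlt
    (Finset.sum_le_sum fun o _ => hle o)

/-- Only the length `a * b` of the interval of score changes matters: the common shift by `l * b`
cancels in the normalized weights. -/
theorem gumbelNoise_topK_mem_le (e : Fin d ≃ Y) (hk : k ≤ d) {b : ℝ} (hb : 0 < b)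
    {u u' : Y → ℝ} {l a δ : ℝ} (ha : 0 < a) (hδ : 0 ≤ δ) (hl : ∀ y, l * b ≤ u y - u' y)
    (hu : ∀ y, u y - u' y ≤ (l + a) * b) (S : Set (Fin k → Y)) :
    gumbelNoise Y b {z | topK e hk (u + z) ∈ S} ≤
      ENNReal.ofReal (Real.exp (composedEps k a δ)) *
        gumbelNoise Y b {z | topK e hk (u' + z) ∈ S} + ENNReal.ofReal δ := by
  classical
  have hcard : k ≤ (Finset.univ : Finset Y).card := by
    rw [Finset.card_univ, ← Fintype.card_congr e, Fintype.card_fin]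
    exact hk
  have hw : ∀ y, 0 < Real.exp (u y / b) := fun y => Real.exp_pos _
  have hw' : ∀ y, 0 < Real.exp (u' y / b) := fun y => Real.exp_pos _
  have hl' : ∀ y, l ≤ u y / b - u' y / b := fun y => by
    rw [← sub_div, le_div_iff₀ hb]; exact hl y
  have hu' : ∀ y, u y / b - u' y / b ≤ l + a := fun y => by
    rw [← sub_div, div_le_iff₀ hb]; exact hu y
  have h1 := Finset.div_sum_le_exp_mul (w := fun y => Real.exp (u y / b))
    (w' := fun y => Real.exp (u' y / b)) hw' (l := l) (u := l + a)
    (fun y => by rw [← Real.exp_add, Real.exp_le_exp]; linarith [hl' y])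
    (fun y => by rw [← Real.exp_add, Real.exp_le_exp]; linarith [hu' y])
  have h2 := Finset.div_sum_le_exp_mul (w := fun y => Real.exp (u' y / b))
    (w' := fun y => Real.exp (u y / b)) hw (l := -(l + a)) (u := -l)
    (fun y => by rw [← Real.exp_add, Real.exp_le_exp]; linarith [hu' y])
    (fun y => by rw [← Real.exp_add, Real.exp_le_exp]; linarith [hl' y])
  rw [show l + a - l = a by ring] at h1
  rw [show -l - -(l + a) = a by ring] at h2
  have hmain := sum_plackettLuce_le_composedEps hw hw' ha hδ h1 h2 hcard S.toFinset
  have hS : ∀ v : Y → ℝ, gumbelNoise Y b {z | topK e hk (v + z) ∈ S} = ENNReal.ofReal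
      (∑ o ∈ S.toFinset, plackettLuce (fun y => Real.exp (v y / b)) k Finset.univ o) := by
    intro v
    rw [ENNReal.ofReal_sum_of_nonneg fun o _ => plackettLuce_nonneg (fun y => Real.exp_pos _) k _ o]
    have := gumbelNoise_topK_mem e hk b v S.toFinset
    simp only [Set.mem_toFinset, gumbelNoise_topK_eq e hk hb v] at this
    exact this
  rw [hS, hS, ← ENNReal.ofReal_mul (Real.exp_pos _).le, ← ENNReal.ofReal_add _ hδ]
  · exact ENNReal.ofReal_le_ofReal hmain
  · exact mul_nonneg (Real.exp_pos _).le
      (Finset.sum_nonneg fun o _ => plackettLuce_nonneg hw' k _ o)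

end NoisyTopK

/-! ### Differential privacy of the mechanism. -/

theorem mainTheorem5 {X Y : Type*} [Fintype Y] {d k : ℕ} (e : Fin d ≃ Y) (hk : k ≤ d)
    (q : Multiset X → Y → ℝ) (Δ ε : ℝ) (hΔ : 0 < Δ) (hq : HasSensitivity q Δ) (hε : 0 < ε) :
    (∀ δ : ℝ, 0 ≤ δ →
      IsDP (gumbelNoise Y (Δ / ε)) (oneShotTopK e hk q) (composedEps k (2 * ε) δ) δ) ∧
    (IsMonotonicScore q → ∀ δ : ℝ, 0 ≤ δ →
      IsDP (gumbelNoise Y (Δ / ε)) (oneShotTopK e hk q) (composedEps k ε δ) δ) := by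
  classical
  have hb : 0 < Δ / ε := div_pos hΔ hε
  have hεb : ε * (Δ / ε) = Δ := mul_div_cancel₀ Δ hε.ne'
  refine ⟨fun δ hδ x x' hx S => ?_, fun hmono δ hδ x x' hx S => ?_⟩
  · refine gumbelNoise_topK_mem_le e hk hb (l := -ε) (by linarith) hδ (fun y => ?_) (fun y => ?_) S
    · have := (abs_le.mp (hq x x' hx y)).1
      linarith
    · have := (abs_le.mp (hq x x' hx y)).2
      linarith
  -- The neighbor relation is symmetric, so either kind of monotonicity can give either sign; what
  -- matters is that the sign is the same for all `y`.
  · have hcases : (∀ y, q x y ≤ q x' y) ∨ ∀ y, q x' y ≤ q x y := by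
      obtain ⟨a, rfl | rfl⟩ := hx <;> rcases hmono with h | h
      exacts [.inl fun y => h _ a y, .inr fun y => h _ a y, .inr fun y => h _ a y,
        .inl fun y => h _ a y]
    rcases hcases with h | h
    · refine gumbelNoise_topK_mem_le e hk hb (l := -ε) hε hδ (fun y => ?_) (fun y => ?_) S
      · have := (abs_le.mp (hq x x' hx y)).1
        linarith
      · linarith [h y]
    · refine gumbelNoise_topK_mem_le e hk hb (l := 0) hε hδ (fun y => ?_) (fun y => ?_) S
      · linarith [h y]
      · have := (abs_le.mp (hq x x' hx y)).2
        linarith
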